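/- Let $K$ be a field, $S=K[x_1,\dots,x_n]$ with its standard $\mathbb Z^n$-grading and $\mathfrak m=(x_1,\dots,x_n)$. A *Stanley decomposition* of a nonzero finitely generated $\mathbb Z^n$-graded $S$-module $M$ is a finite direct sum decomposition $\mathcal D: M=\bigoplus_{i=1}^r v_iK[Z_i]$ of $\mathbb Z^n$-graded $K$-vector spaces, where each $v_i\in M$ is homogeneous, $Z_i\subseteq\{x_1,\dots,x_n\}$, and $v_iK[Z_i]=\{uv_i : u\in K[Z_i]\}$ is a free $K[Z_i]$-module with basis $v_i$. Put $\operatorname{sdepth}(\mathcal D)=\min_i|Z_i|$, let $\operatorname{sdepth}_S(M)$ be the maximum of $\operatorname{sdepth}(\mathcal D)$ over all Stanley decompositions $\mathcal D$ of $M$, and let $\operatorname{depth}_S(M)$ be the maximal length of an $M$-regular sequence in $\mathfrak m$. **Theorem 1.5.** Let $0\le m\le n$ be integers, let $a_i\ge1$ for $1\le i\le n$ and $b_i\ge a_i$ for $1\le i\le m$ be integers, and put $J=(x_1^{a_1},\dots,x_n^{a_n})$, $I=(x_1^{b_1},\dots,x_m^{b_m})\subseteq J$. Assume $I\ne J$ (that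 is, if $m=n$, then $a_i<b_i$ for some $i$). Then $$\operatorname{sdepth}_S(J/I)=n-m-\left\lfloor\frac{n-m}{2}\right\rfloor .$$ Moreover $\operatorname{depth}_S(J/I)=1$ if $m<n$ and $\operatorname{depth}_S(J/I)=0$ if $m=n$; consequently $\operatorname{sdepth}_S(J/I)\ge\operatorname{depth}_S(J/I)$. -/

import Mathlib

noncomputable section

namespace StanleyDepth

open MvPolynomial

section General

variable {K : Type*} [Field K] {n : ℕ} {M : Type*} [AddCommGroup M]
  [Module (MvPolynomial (Fin n) K) M] [Module K M] [IsScalarTower K (MvPolynomial (Fin n) K) M]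

/-- The `K`-linear map `K[Z] → M`, `u ↦ u • v`, where `K[Z]` is the polynomial subring of
`K[x_1, …, x_n]` in the variables indexed by `Z`. -/
def stanleyMap (v : M) (Z : Finset (Fin n)) : supported K (Z : Set (Fin n)) →ₗ[K] M where
  toFun u := (u : MvPolynomial (Fin n) K) • v
  map_add' u w := add_smul (u : MvPolynomial (Fin n) K) (w : MvPolynomial (Fin n) K) v
  map_smul' c u := smul_assoc c (u : MvPolynomial (Fin n) K) v

/-- A Stanley decomposition `M = ⨁_{i=1}^r v_i K[Z_i]` of a `ℤⁿ`-graded module `M` over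
`K[x_1, …, x_n]`, whose graded pieces are the subspaces `𝓜 d`, `d ∈ ℤⁿ`: each `v_i` is homogeneous,
each `v_i K[Z_i]` is a free `K[Z_i]`-module on `v_i`, and `M` is the (internal) direct sum of these
subspaces. As the `v_i` are homogeneous, each `v_i K[Z_i]` is a graded subspace, so that the
decomposition is automatically one of `ℤⁿ`-graded vector spaces. -/
structure StanleyDecomposition (𝓜 : (Fin n → ℤ) → Submodule K M) where
  /-- the number of summands -/
  r : ℕ
  /-- the generators of the summands -/
  v : Fin r → M
  /-- the sets of variables of the summands -/
  Z : Fin r → Finset (Fin n)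
  homogeneous : ∀ i, ∃ d, v i ∈ 𝓜 d
  free : ∀ i, Function.Injective (stanleyMap (K := K) (v i) (Z i))
  internal : DirectSum.IsInternal fun i => LinearMap.range (stanleyMap (K := K) (v i) (Z i))

/-- `sdepth 𝓓 = min_i |Z_i|`. (A decomposition of a nonzero module has at least one summand.) -/
def StanleyDecomposition.sdepth {𝓜 : (Fin n → ℤ) → Submodule K M}
    (D : StanleyDecomposition 𝓜) : ℕ :=
  ⨅ i, (D.Z i).card

/-- The Stanley depth of a `ℤⁿ`-graded module: the largest `sdepth 𝓓` of a Stanley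
decomposition `𝓓`. -/
def sdepth (𝓜 : (Fin n → ℤ) → Submodule K M) : ℕ :=
  sSup (Set.range fun D : StanleyDecomposition 𝓜 => D.sdepth)

variable (K n M) in
/-- The depth of a module over `S = K[x_1, …, x_n]`: the largest length of an `M`-regular sequence
of elements of the ideal `(x_1, …, x_n)`. -/
def depth : ℕ∞ :=
  ⨆ rs : {rs : List (MvPolynomial (Fin n) K) //
      (∀ f ∈ rs, f ∈ Ideal.span (Set.range (X : Fin n → MvPolynomial (Fin n) K))) ∧
        RingTheory.Sequence.IsRegular M rs},
    (rs.1.length : ℕ∞)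

end General

variable {K : Type*} [Field K] {n : ℕ}

/-- The ideal `(x_1^{e_1}, …, x_k^{e_k})` of `K[x_1, …, x_n]`, for `k ≤ n`. -/
def powerIdeal (K : Type*) [Field K] {n k : ℕ} (h : k ≤ n) (e : Fin k → ℕ) :
    Ideal (MvPolynomial (Fin n) K) :=
  Ideal.span (Set.range fun i : Fin k => X (Fin.castLE h i) ^ e i)

/-- The module `J / I`, for ideals `I ⊆ J`. -/
abbrev IdealQuotient (J I : Ideal (MvPolynomial (Fin n) K)) : Type _ :=
  ↥J ⧸ Submodule.submoduleOf I J

/-- The `ℤⁿ`-grading of `J / I`, for monomial ideals `I ⊆ J`: the piece of degree `d` consists of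
the classes of the elements of `J` that are homogeneous of multidegree `d`, where `x_i` has as its
degree the `i`-th standard basis vector of `ℤⁿ`. -/
def quotientGrading (J I : Ideal (MvPolynomial (Fin n) K)) (d : Fin n → ℤ) :
    Submodule K (IdealQuotient J I) :=
  ((weightedHomogeneousSubmodule K (fun i : Fin n => (Pi.single i 1 : Fin n → ℤ)) d).comap
      (J.subtype.restrictScalars K)).map
    ((Submodule.mkQ (Submodule.submoduleOf I J)).restrictScalars K)

end StanleyDepth

end

noncomputable section

namespace StanleyDepth

open MvPolynomial

/-! ### Interval partitions of the nonempty subsets of a finite set -/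

section IntervalPartition

/-! The monomials in `J` but not in `I` form a basis of `J / I`, and homogeneous elements are scalar
multiples of monomial classes. A Stanley decomposition is therefore the same as a finite partition
of the exponent set into cells (`StanleyDecomposition.exists_cells`, `exists_stanleyDecomposition`),
and its depth is combinatorial. Let `W` index the generators of `I`, put `N = n - m = |Wᶜ|`, and let
`c = a - 1` be the exponent of the socle monomial of `S / J`.

Upper bound (`le_of_cell_partition`): for `i ∉ W`, the cell through `c + e_i` has free directions
only in `Wᶜ`. Sending each free direction `l` to the unordered pair `{i, l}` is injective, so `N k ≤
N (N + 1) / 2`.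

Lower bound (`exists_cell_partition`): the nonempty subsets of `Wᶜ` split into intervals with
nonempty bottom and top of size at least `N / 2`. Applied to the set of `i ∉ W` with `a i ≤ α i`,
this gives the cells. The intervals come from tiling a cyclic word of odd length.

Depth: if `m = n`, then `x^(b-1)` is a socle element of `J / I`. If `m < n`, a variable outside `W`
is regular, and every regular `f ∈ 𝔪` leaves the socle element `f x^c` in `(J / I) / f (J / I)`. -/

/-- `E` marks the second positions in the tiling of the cyclic binary word of `S` by the tiles
`1`, `00` and `10`. -/
def IsTiling {N : ℕ} (S : Finset (ZMod N)) (E : ZMod N → Prop) : Prop :=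
  ∀ i, E i ↔ i ∉ S ∧ ¬ E (i + 1)

/-- `E` is false on `S`, and `E (i + 1)` determines `E i`; so one element of `S` fixes everything,
walking backwards around the cycle. -/
theorem IsTiling.unique {N : ℕ} [NeZero N] {S : Finset (ZMod N)} (hS : S.Nonempty)
    {E E' : ZMod N → Prop} (hE : IsTiling S E) (hE' : IsTiling S E') : E = E' := by
  obtain ⟨s, hs⟩ := hS
  have key : ∀ (t : ℕ) (i : ZMod N), i + t ∈ S → (E i ↔ E' i) := by
    intro t
    induction t with
    | zero =>
      intro i hi
      rw [Nat.cast_zero, add_zero] at hi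
      rw [hE i, hE' i]
      tauto
    | succ t ih =>
      intro i hi
      have := ih (i + 1) (by convert hi using 1; push_cast; ring)
      rw [hE i, hE' i, this]
  funext i
  refine propext (key (s - i).val i ?_)
  rwa [ZMod.natCast_zmod_val, add_sub_cancel]

theorem exists_isTiling {N : ℕ} [NeZero N] {S : Finset (ZMod N)} (hS : S.Nonempty) :
    ∃ E, IsTiling S E := by
  classical
  obtain ⟨s, hs⟩ := hS
  have hex : ∀ i : ZMod N, ∃ t : ℕ, i + t ∈ S := fun i =>
    ⟨(s - i).val, by rwa [ZMod.natCast_zmod_val, add_sub_cancel]⟩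
  -- The distance from `i` to the next element of `S` drops by one at each step forward off `S`, so
  -- its parity alternates as required.
  refine ⟨fun i => Odd (Nat.find (hex i)), fun i => ?_⟩
  by_cases hi : i ∈ S
  · have : Nat.find (hex i) = 0 := by
      rw [Nat.find_eq_zero]
      simpa using hi
    simp [this, hi]
  · have : Nat.find (hex i) = Nat.find (hex (i + 1)) + 1 := by
      have h0 : ¬ (i + (0 : ℕ) ∈ S) := by simpa using hi
      rw [Nat.find_comp_succ (hex i) ?_ h0]
      · congr 1
        apply Nat.find_congr'
        intro t
        push_cast
        rw [add_assoc, add_comm (1 : ZMod N)]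
      · obtain ⟨t, ht⟩ := hex (i + 1)
        exact ⟨t, by convert ht using 1; push_cast; ring⟩
    simp only [this, hi, not_false_eq_true, true_and, Nat.odd_add_one]

/-- The nonempty subsets of a cycle of odd length `N` are partitioned into intervals `[X, Y]` with
`X` nonempty and `|Y| ≥ (N + 1) / 2`. -/
theorem exists_interval_partition_zmod {N : ℕ} (hN : Odd N) :
    ∃ X Y : Finset (ZMod N) → Finset (ZMod N), ∀ S, S.Nonempty →
      X S ⊆ S ∧ S ⊆ Y S ∧ (X S).Nonempty ∧ N + 1 ≤ 2 * (Y S).card ∧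
      ∀ T, X S ⊆ T → T ⊆ Y S → X T = X S ∧ Y T = Y S := by
  classical
  have : NeZero N := ⟨by rintro rfl; simp at hN⟩
  have hex : ∀ S : Finset (ZMod N), ∃ E, S.Nonempty → IsTiling S E := fun S => by
    by_cases hS : S.Nonempty
    · obtain ⟨E, hE⟩ := exists_isTiling hS
      exact ⟨E, fun _ => hE⟩
    · exact ⟨fun _ => True, fun h => absurd h hS⟩
  choose E hE using hex
  -- The bottom consists of the one-letter tiles `1`; the top omits only the second positions.
  -- Between them, the first letter of each two-letter tile is free.
  refine ⟨fun S => Finset.univ.filter fun i => ¬ E S i ∧ ¬ E S (i + 1),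
    fun S => Finset.univ.filter fun i => ¬ E S i, fun S hS => ?_⟩
  have ht := hE S hS
  set X := Finset.univ.filter fun i => ¬ E S i ∧ ¬ E S (i + 1) with hX
  set Y := Finset.univ.filter fun i => ¬ E S i with hY
  have hcard : Y.card = X.card + (Finset.univ.filter fun i => E S i).card := by
    have h1 : (Finset.univ.filter fun i => E S i).card
        = (Finset.univ.filter fun i => E S (i + 1)).card := by
      symm
      refine Finset.card_bij (fun i _ => i + 1) ?_ ?_ ?_
      · intro i hi; simpa using hi
      · intro i _ j _ h; simpa using h
      · intro j hj; exact ⟨j - 1, by simpa using hj, by simp⟩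
    rw [h1, ← Finset.card_union_of_disjoint]
    · congr 1
      ext i
      have := ht i
      simp only [hX, hY, Finset.mem_filter, Finset.mem_univ, true_and, Finset.mem_union]
      tauto
    · rw [Finset.disjoint_left]
      intro i
      simp only [hX, Finset.mem_filter, Finset.mem_univ, true_and]
      tauto
  have htot : (Finset.univ.filter fun i => E S i).card + Y.card = N := by
    rw [hY, Finset.card_filter_add_card_filter_not, Finset.card_univ, ZMod.card]
  -- The counts give `2 |Y| = N + |X|`, so `|X|` has the parity of `N`; this is where oddness
  -- enters.
  have hXne : X.Nonempty := by
    rw [← Finset.card_pos]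
    obtain ⟨k, hk⟩ := hN
    omega
  refine ⟨?_, ?_, hXne, ?_, ?_⟩
  · intro i hi
    have := ht i
    simp only [Finset.mem_filter, Finset.mem_univ, true_and] at hi
    tauto
  · intro i hi
    have := ht i
    simp only [Finset.mem_filter, Finset.mem_univ, true_and]
    tauto
  · have := Finset.card_pos.2 hXne
    change N + 1 ≤ 2 * Y.card
    omega
  · intro T hXT hTY
    have hT : T.Nonempty := hXne.mono hXT
    -- Changing first letters of two-letter tiles keeps the same tiling valid, so uniqueness
    -- applies.
    have : E T = E S := by
      refine (hE T hT).unique hT fun i => ?_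
      have h1 := ht i
      have h2 : ¬ E S i → ¬ E S (i + 1) → i ∈ T := fun h h' => hXT (by simp [h, h'])
      have h3 : i ∈ T → ¬ E S i := fun h => by simpa [hY] using hTY h
      tauto
    simp only [this, and_self]

/-- The nonempty subsets of an `N`-element set are partitioned into intervals `[X, Y]` with `X`
nonempty and `|Y| ≥ N / 2`. -/
theorem exists_interval_partition {ι : Type*} [Fintype ι] [DecidableEq ι] :
    ∃ X Y : Finset ι → Finset ι, ∀ S, S.Nonempty →
      X S ⊆ S ∧ S ⊆ Y S ∧ (X S).Nonempty ∧ Fintype.card ι ≤ 2 * (Y S).card ∧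
      ∀ T, X S ⊆ T → T ⊆ Y S → X T = X S ∧ Y T = Y S := by
  -- An even set is padded by one point to an odd cycle. Restricting costs the top at most that
  -- point, which the bound `(N + 1) / 2` can afford.
  obtain ⟨N, hN, f, hc⟩ : ∃ N, Odd N ∧ ∃ f : ι ↪ ZMod N, N ≤ Fintype.card ι + 1 := by
    obtain ⟨N, hN, h1, h2⟩ : ∃ N, Odd N ∧ Fintype.card ι ≤ N ∧ N ≤ Fintype.card ι + 1 := by
      rcases Nat.even_or_odd (Fintype.card ι) with h | h
      · exact ⟨_, h.add_one, by omega, le_rfl⟩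
      · exact ⟨_, h, le_rfl, by omega⟩
    have : NeZero N := ⟨by rintro rfl; simp at hN⟩
    exact ⟨N, hN, (Function.Embedding.nonempty_of_card_le (by rwa [ZMod.card])).some, h2⟩
  have : NeZero N := ⟨by rintro rfl; simp at hN⟩
  obtain ⟨X, Y, h⟩ := exists_interval_partition_zmod hN
  refine ⟨fun S => Finset.univ.filter fun i => f i ∈ X (S.map f),
    fun S => Finset.univ.filter fun i => f i ∈ Y (S.map f), fun S hS => ?_⟩
  obtain ⟨h1, h2, h3, h4, h5⟩ := h (S.map f) (hS.map)
  refine ⟨?_, ?_, ?_, ?_, ?_⟩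
  · intro i hi
    simpa using h1 (Finset.mem_filter.1 hi).2
  · intro i hi
    simpa using h2 (Finset.mem_map_of_mem f hi)
  · obtain ⟨x, hx⟩ := h3
    obtain ⟨i, _, rfl⟩ := Finset.mem_map.1 (h1 hx)
    exact ⟨i, by simpa using hx⟩
  · have hsub : Y (S.map f) ⊆ (Finset.univ.filter fun i => f i ∈ Y (S.map f)).map f ∪
        (Finset.univ \ Finset.univ.map f) := by
      intro y hy
      by_cases hyf : ∃ i, f i = y
      · obtain ⟨i, rfl⟩ := hyf
        simp [hy]
      · simp only [Finset.mem_union, Finset.mem_sdiff, Finset.mem_univ, Finset.mem_map, true_and]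
        exact Or.inr hyf
    have hle := (Finset.card_le_card hsub).trans (Finset.card_union_le _ _)
    rw [Finset.card_map, Finset.card_sdiff_of_subset (Finset.subset_univ _), Finset.card_map,
      Finset.card_univ, Finset.card_univ, ZMod.card] at hle
    have hle' := Fintype.card_le_of_embedding f
    rw [ZMod.card] at hle'
    dsimp only
    omega
  · intro T hXT hTY
    have := h5 (T.map f) ?_ ?_
    · simp only [this, and_self]
    · intro x hx
      obtain ⟨i, _, rfl⟩ := Finset.mem_map.1 (h1 hx)
      exact Finset.mem_map_of_mem f (hXT (by simpa using hx))
    · intro x hx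
      obtain ⟨i, hi, rfl⟩ := Finset.mem_map.1 hx
      simpa using hTY hi

/-- The nonempty subsets of a finite set `V` are partitioned into intervals `[X, Y]` with `X`
nonempty and `|Y| ≥ |V| / 2`. -/
theorem exists_interval_partition_finset {κ : Type*} [DecidableEq κ] (V : Finset κ) :
    ∃ X Y : Finset κ → Finset κ, ∀ S, S ⊆ V → S.Nonempty →
      X S ⊆ S ∧ S ⊆ Y S ∧ Y S ⊆ V ∧ (X S).Nonempty ∧ V.card ≤ 2 * (Y S).card ∧
      ∀ T, X S ⊆ T → T ⊆ Y S → X T = X S ∧ Y T = Y S := by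
  obtain ⟨X, Y, h⟩ := exists_interval_partition (ι := V)
  refine ⟨fun S => (X (S.subtype (· ∈ V))).map (Function.Embedding.subtype _),
    fun S => (Y (S.subtype (· ∈ V))).map (Function.Embedding.subtype _), fun S hSV hS => ?_⟩
  have hS' : (S.subtype (· ∈ V)).Nonempty := by
    obtain ⟨s, hs⟩ := hS
    exact ⟨⟨s, hSV hs⟩, by simpa using hs⟩
  obtain ⟨h1, h2, h3, h4, h5⟩ := h _ hS'
  refine ⟨?_, ?_, ?_, h3.map, ?_, ?_⟩
  · intro i hi
    obtain ⟨x, hx, rfl⟩ := Finset.mem_map.1 hi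
    exact Finset.mem_subtype.1 (h1 hx)
  · intro i hi
    exact Finset.mem_map.2 ⟨⟨i, hSV hi⟩, h2 (Finset.mem_subtype.2 hi), rfl⟩
  · intro i hi
    obtain ⟨x, hx, rfl⟩ := Finset.mem_map.1 hi
    exact x.2
  · rwa [Finset.card_map, ← Fintype.card_coe V]
  · intro T hXT hTY
    have := h5 (T.subtype (· ∈ V)) ?_ ?_
    · simp only [this, and_self]
    · intro x hx
      exact Finset.mem_subtype.2 (hXT (Finset.mem_map_of_mem _ hx))
    · intro x hx
      obtain ⟨y, hy, hyx⟩ := Finset.mem_map.1 (hTY (Finset.mem_subtype.1 hx))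
      rwa [← show y = x from Subtype.ext hyx]

end IntervalPartition

/-! ### Stanley decompositions of `J / I` as partitions of exponents into cells -/

section MonomialIdeal

variable {K : Type*} [Field K] {n : ℕ}

/-- `I` is the monomial ideal spanned by the monomials with exponents in `A`. -/
def IsMonomialIdeal (I : Ideal (MvPolynomial (Fin n) K)) (A : Set (Fin n →₀ ℕ)) : Prop :=
  ∀ p, p ∈ I ↔ ∀ α ∈ p.support, α ∈ A

theorem IsMonomialIdeal.monomial_mem_iff {I : Ideal (MvPolynomial (Fin n) K)}
    {A : Set (Fin n →₀ ℕ)} (hI : IsMonomialIdeal I A) {α : Fin n →₀ ℕ} {c : K} (hc : c ≠ 0) :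
    monomial α c ∈ I ↔ α ∈ A := by
  classical
  rw [hI, support_monomial, if_neg hc]
  simp

theorem IsMonomialIdeal.add_mem {I : Ideal (MvPolynomial (Fin n) K)}
    {A : Set (Fin n →₀ ℕ)} (hI : IsMonomialIdeal I A) {α : Fin n →₀ ℕ} (hα : α ∈ A)
    (β : Fin n →₀ ℕ) : β + α ∈ A := by
  rw [← hI.monomial_mem_iff (one_ne_zero (α := K))] at hα ⊢
  have := I.mul_mem_left (monomial β 1) hα
  rwa [monomial_mul, one_mul] at this

theorem isMonomialIdeal_powerIdeal {k : ℕ} (h : k ≤ n) (e : Fin k → ℕ) :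
    IsMonomialIdeal (powerIdeal K h e) {α | ∃ i, e i ≤ α (Fin.castLE h i)} := by
  intro p
  have : powerIdeal K h e = Ideal.span ((fun s => monomial s (1 : K)) ''
      (Set.range fun i : Fin k => Finsupp.single (Fin.castLE h i) (e i))) := by
    rw [powerIdeal, ← Set.range_comp]
    congr 2
    funext i
    simp [X_pow_eq_monomial]
  rw [this, mem_ideal_span_monomial_image]
  simp

variable {J I : Ideal (MvPolynomial (Fin n) K)} {A B : Set (Fin n →₀ ℕ)}

variable (J) in
/-- The coefficients of an element of `J` at the exponents in `T`. -/
def coeffMap (T : Set (Fin n →₀ ℕ)) : J →ₗ[K] (T →₀ K) :=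
  Finsupp.lsubtypeDomain T ∘ₗ (basisMonomials (Fin n) K).repr.toLinearMap ∘ₗ
    J.subtype.restrictScalars K

theorem coeffMap_apply (T : Set (Fin n →₀ ℕ)) (p : J) (t : T) :
    coeffMap J T p t = coeff t.1 p.1 := rfl

theorem ker_coeffMap (hJ : IsMonomialIdeal J A) (hI : IsMonomialIdeal I B) :
    LinearMap.ker (coeffMap J (A \ B)) = (Submodule.submoduleOf I J).restrictScalars K := by
  ext p
  rw [LinearMap.mem_ker, Submodule.restrictScalars_mem,
    show p ∈ Submodule.submoduleOf I J ↔ p.1 ∈ I from Iff.rfl, hI, Finsupp.ext_iff]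
  simp only [coeffMap_apply, Finsupp.coe_zero, Pi.zero_apply]
  constructor
  · intro h α hα
    by_contra hB
    exact mem_support_iff.1 hα (h ⟨α, (hJ _).1 p.2 α hα, hB⟩)
  · intro h t
    by_contra ht
    exact t.2.2 (h _ (mem_support_iff.2 ht))

theorem coeffMap_surjective (hJ : IsMonomialIdeal J A) (B : Set (Fin n →₀ ℕ)) :
    Function.Surjective (coeffMap J (A \ B)) := by
  classical
  intro f
  induction f using Finsupp.induction_linear with
  | zero => exact ⟨0, map_zero _⟩
  | add f g hf hg =>
    obtain ⟨p, rfl⟩ := hf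
    obtain ⟨q, rfl⟩ := hg
    exact ⟨p + q, map_add _ _ _⟩
  | single t c =>
    have ht : monomial t.1 c ∈ J := by
      rcases eq_or_ne c 0 with rfl | hc
      · simp
      · exact (hJ.monomial_mem_iff hc).2 t.2.1
    refine ⟨⟨monomial t.1 c, ht⟩, Finsupp.ext fun s => ?_⟩
    rw [coeffMap_apply, coeff_monomial, Finsupp.single_apply]
    simp only [Subtype.ext_iff]

/-- The monomials in `J` but not in `I` form a `K`-basis of `J / I`. -/
def quotientBasis (hJ : IsMonomialIdeal J A) (hI : IsMonomialIdeal I B) :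
    Module.Basis ↥(A \ B) K (IdealQuotient J I) :=
  .ofRepr <| (Submodule.Quotient.restrictScalarsEquiv K (Submodule.submoduleOf I J)).symm ≪≫ₗ
    Submodule.quotEquivOfEq _ _ (ker_coeffMap hJ hI).symm ≪≫ₗ
    LinearMap.quotKerEquivOfSurjective _ (coeffMap_surjective hJ B)

/-- The class in `J / I` of an element of `J`. -/
abbrev toQuotient (I : Ideal (MvPolynomial (Fin n) K)) (p : J) : IdealQuotient J I :=
  Submodule.Quotient.mk p

theorem toQuotient_eq_zero {p : J} : toQuotient I p = 0 ↔ p.1 ∈ I :=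
  Submodule.Quotient.mk_eq_zero _

theorem quotientBasis_repr (hJ : IsMonomialIdeal J A) (hI : IsMonomialIdeal I B) (p : J)
    (t : ↥(A \ B)) : (quotientBasis hJ hI).repr (toQuotient I p) t = coeff t.1 p.1 := rfl

theorem quotientBasis_apply (hJ : IsMonomialIdeal J A) (hI : IsMonomialIdeal I B)
    (t : ↥(A \ B)) : quotientBasis hJ hI t =
      toQuotient I ⟨monomial t.1 1, (hJ.monomial_mem_iff one_ne_zero).2 t.2.1⟩ := by
  classical
  apply (quotientBasis hJ hI).repr.injective
  ext s
  rw [quotientBasis_repr, Module.Basis.repr_self, coeff_monomial, Finsupp.single_apply]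
  simp only [Subtype.ext_iff]

/-- The exponents of the monomials in `x^δ K[Z]`. -/
def cell (δ : Fin n →₀ ℕ) (Z : Finset (Fin n)) : Set (Fin n →₀ ℕ) :=
  {α | δ ≤ α ∧ ∀ i ∉ Z, α i = δ i}

theorem self_mem_cell (δ : Fin n →₀ ℕ) (Z : Finset (Fin n)) : δ ∈ cell δ Z :=
  ⟨le_rfl, fun _ _ => rfl⟩

theorem mem_supported_iff {u : MvPolynomial (Fin n) K} {Z : Finset (Fin n)} :
    u ∈ supported K (Z : Set (Fin n)) ↔ ∀ β ∈ u.support, ∀ i ∉ Z, β i = 0 := by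
  rw [mem_supported, Set.subset_def]
  simp only [Finset.mem_coe, mem_vars_iff_mem_support, Finsupp.mem_support_iff]
  constructor
  · intro h β hβ i hi
    by_contra h0
    exact hi (h i ⟨β, hβ, h0⟩)
  · rintro h i ⟨β, hβ, h0⟩
    by_contra hi
    exact h0 (h β hβ i hi)

theorem monomial_sub_mem_supported {δ α : Fin n →₀ ℕ} {Z : Finset (Fin n)} (hα : α ∈ cell δ Z)
    (c : K) : monomial (α - δ) c ∈ supported K (Z : Set (Fin n)) := by
  rw [mem_supported_iff]
  intro β hβ i hi
  rw [Finset.mem_singleton.1 (support_monomial_subset hβ), Finsupp.tsub_apply, hα.2 i hi,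
    Nat.sub_self]

theorem stanleyMap_toQuotient (p : J) (Z : Finset (Fin n)) (u : supported K (Z : Set (Fin n))) :
    stanleyMap (K := K) (toQuotient I p) Z u =
      toQuotient I ⟨u.1 * p.1, J.mul_mem_left _ p.2⟩ := rfl

theorem stanleyMap_monomial_sub {δ α : Fin n →₀ ℕ} {Z : Finset (Fin n)} (hα : α ∈ cell δ Z)
    {c : K} (h : monomial δ c ∈ J) (d : K) :
    stanleyMap (K := K) (toQuotient I ⟨monomial δ c, h⟩) Z
      ⟨monomial (α - δ) d, monomial_sub_mem_supported hα d⟩ =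
      toQuotient I ⟨monomial α (d * c), by
        have := J.mul_mem_left (monomial (α - δ) d) h
        rwa [monomial_mul, tsub_add_cancel_of_le hα.1] at this⟩ := by
  rw [stanleyMap_toQuotient]
  congr 2
  rw [monomial_mul, tsub_add_cancel_of_le hα.1]

/-- Multiplication by a monomial shifts exponents injectively, so freeness can fail only when some
monomial of the cell lands in `I`. -/
theorem injective_stanleyMap_iff (hJ : IsMonomialIdeal J A) (hI : IsMonomialIdeal I B)
    {δ : Fin n →₀ ℕ} {c : K} (hc : c ≠ 0) (h : monomial δ c ∈ J) (Z : Finset (Fin n)) :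
    Function.Injective (stanleyMap (K := K) (toQuotient I ⟨monomial δ c, h⟩) Z) ↔
      cell δ Z ⊆ A \ B := by
  constructor
  · intro hinj α hα
    have hne : stanleyMap (K := K) (toQuotient I ⟨monomial δ c, h⟩) Z
        ⟨monomial (α - δ) 1, monomial_sub_mem_supported hα 1⟩ ≠ 0 := by
      intro h0
      have := hinj (h0.trans (map_zero _).symm)
      rw [Subtype.ext_iff] at this
      exact one_ne_zero (monomial_eq_zero.1 this)
    rw [stanleyMap_monomial_sub hα, Ne, toQuotient_eq_zero,
      hI.monomial_mem_iff (mul_ne_zero one_ne_zero hc)] at hne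
    refine ⟨?_, hne⟩
    have := hJ.add_mem ((hJ.monomial_mem_iff hc).1 h) (α - δ)
    rwa [tsub_add_cancel_of_le hα.1] at this
  · intro hsub
    rw [injective_iff_map_eq_zero]
    intro u hu
    rw [stanleyMap_toQuotient, toQuotient_eq_zero, hI] at hu
    have hu0 : u.1 = 0 := by
      rw [← support_eq_empty, Finset.eq_empty_iff_forall_notMem]
      intro β hβ
      have hcell : β + δ ∈ cell δ Z :=
        ⟨le_add_self, fun i hi => by
          rw [Finsupp.add_apply, mem_supported_iff.1 u.2 β hβ i hi, zero_add]⟩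
      refine (hsub hcell).2 (hu _ ?_)
      rw [mem_support_iff, coeff_mul_monomial]
      exact mul_ne_zero (mem_support_iff.1 hβ) hc
    exact Subtype.ext hu0

theorem range_stanleyMap (hJ : IsMonomialIdeal J A) (hI : IsMonomialIdeal I B)
    {δ : Fin n →₀ ℕ} {c : K} (hc : c ≠ 0) (h : monomial δ c ∈ J) (Z : Finset (Fin n)) :
    LinearMap.range (stanleyMap (K := K) (toQuotient I ⟨monomial δ c, h⟩) Z) =
      Submodule.span K (quotientBasis hJ hI '' (Subtype.val ⁻¹' cell δ Z)) := by
  apply le_antisymm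
  · rintro _ ⟨u, rfl⟩
    rw [Module.Basis.mem_span_image, stanleyMap_toQuotient]
    intro t ht
    rw [Finset.mem_coe, Finsupp.mem_support_iff, quotientBasis_repr, coeff_mul_monomial'] at ht
    split_ifs at ht with hle
    · refine ⟨hle, fun i hi => ?_⟩
      have := mem_supported_iff.1 u.2 _ (mem_support_iff.2 (left_ne_zero_of_mul ht)) i hi
      rw [Finsupp.tsub_apply] at this
      have := hle i
      omega
    · exact absurd rfl ht
  · rw [Submodule.span_le]
    rintro _ ⟨t, ht, rfl⟩
    refine ⟨⟨monomial (t.1 - δ) c⁻¹, monomial_sub_mem_supported ht _⟩, ?_⟩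
    rw [stanleyMap_monomial_sub ht, quotientBasis_apply]
    congr 2
    rw [inv_mul_cancel₀ hc]

theorem weight_single_one (α : Fin n →₀ ℕ) (i : Fin n) :
    Finsupp.weight (fun i : Fin n => (Pi.single i 1 : Fin n → ℤ)) α i = α i := by
  rw [Finsupp.weight_apply, Finsupp.sum_fintype _ _ (by simp)]
  simp [Finset.sum_apply, Pi.single_apply]

theorem toQuotient_monomial_mem_quotientGrading {δ : Fin n →₀ ℕ} {c : K}
    (h : monomial δ c ∈ J) :
    toQuotient I ⟨monomial δ c, h⟩ ∈ quotientGrading J I fun i => (δ i : ℤ) :=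
  ⟨⟨monomial δ c, h⟩, isWeightedHomogeneous_monomial _ _ _ (funext (weight_single_one δ)), rfl⟩

/-- In the fine grading the multidegree of a monomial is its exponent, so each piece contains at
most one monomial up to scalars. -/
theorem exists_eq_toQuotient_monomial {d : Fin n → ℤ} {v : IdealQuotient J I}
    (hv : v ∈ quotientGrading J I d) (hv0 : v ≠ 0) :
    ∃ (δ : Fin n →₀ ℕ) (c : K) (h : monomial δ c ∈ J), c ≠ 0 ∧
      v = toQuotient I ⟨monomial δ c, h⟩ := by
  obtain ⟨p, hp, rfl⟩ := hv
  have hp : IsWeightedHomogeneous _ p.1 d := hp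
  have hp0 : p.1 ≠ 0 := by
    intro h0
    exact hv0 (by rw [show p = 0 from Subtype.ext h0, map_zero])
  obtain ⟨δ, hδ⟩ := support_nonempty.2 hp0
  have huniq : ∀ α ∈ p.1.support, α = δ := fun α hα => by
    have h1 := hp (mem_support_iff.1 hα)
    have h2 := hp (mem_support_iff.1 hδ)
    ext i
    have := congrFun (h1.trans h2.symm) i
    rw [weight_single_one, weight_single_one] at this
    exact_mod_cast this
  have hpm : p.1 = monomial δ (coeff δ p.1) := by
    conv_lhs => rw [as_sum p.1, (Finset.eq_singleton_iff_unique_mem.2 ⟨hδ, huniq⟩ :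
      p.1.support = {δ}), Finset.sum_singleton]
  refine ⟨δ, coeff δ p.1, hpm ▸ p.2, mem_support_iff.1 hδ, ?_⟩
  change toQuotient I p = _
  congr 1
  exact Subtype.ext hpm

/-- The exponents of the monomials in `J` but not in `I` are partitioned by the cells of a Stanley
decomposition of `J / I`. -/
theorem StanleyDecomposition.exists_cells (hJ : IsMonomialIdeal J A) (hI : IsMonomialIdeal I B)
    (D : StanleyDecomposition (quotientGrading J I)) :
    ∃ δ : Fin D.r → Fin n →₀ ℕ, (∀ i, cell (δ i) (D.Z i) ⊆ A \ B) ∧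
      (∀ α ∈ A \ B, ∃ i, α ∈ cell (δ i) (D.Z i)) ∧
      ∀ i j α, α ∈ cell (δ i) (D.Z i) → α ∈ cell (δ j) (D.Z j) → i = j := by
  have hv : ∀ i, D.v i ≠ 0 := by
    intro i h0
    have h1 := (injective_iff_map_eq_zero _).1 (D.free i) 1 (by
      change (1 : MvPolynomial (Fin n) K) • D.v i = 0
      rw [h0, smul_zero])
    exact one_ne_zero h1
  choose d hd using D.homogeneous
  choose δ c h hc hvδ using fun i => exists_eq_toQuotient_monomial (hd i) (hv i)
  have hsub : ∀ i, cell (δ i) (D.Z i) ⊆ A \ B := fun i => by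
    rw [← injective_stanleyMap_iff hJ hI (hc i) (h i), ← hvδ i]
    exact D.free i
  have hrange : ∀ i, LinearMap.range (stanleyMap (K := K) (D.v i) (D.Z i)) =
      Submodule.span K (quotientBasis hJ hI '' (Subtype.val ⁻¹' cell (δ i) (D.Z i))) := fun i => by
    rw [hvδ i, range_stanleyMap hJ hI (hc i)]
  have hint := D.internal
  simp only [hrange] at hint
  refine ⟨δ, hsub, fun α hα => ?_, fun i j α hi hj => ?_⟩
  · have htop := hint.submodule_iSup_eq_top
    rw [← Submodule.span_iUnion, ← Set.image_iUnion] at htop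
    have : quotientBasis hJ hI ⟨α, hα⟩ ∈ Submodule.span K (quotientBasis hJ hI ''
      ⋃ i, (Subtype.val ⁻¹' cell (δ i) (D.Z i))) := htop ▸ Submodule.mem_top
    rw [Module.Basis.mem_span_image, Module.Basis.repr_self,
      Finsupp.support_single _ one_ne_zero, Finset.coe_singleton,
      Set.singleton_subset_iff, Set.mem_iUnion] at this
    exact this
  · by_contra hij
    have hdis := hint.submodule_iSupIndep.pairwiseDisjoint hij
    have hα := hsub i hi
    refine (quotientBasis hJ hI).ne_zero ⟨α, hα⟩ (Submodule.disjoint_def.1 hdis _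
      (Submodule.subset_span ⟨⟨α, hα⟩, hi, rfl⟩) (Submodule.subset_span ⟨⟨α, hα⟩, hj, rfl⟩))

/-- A finite partition into cells of the exponents of the monomials in `J` but not in `I` gives
a Stanley decomposition of `J / I`. -/
theorem exists_stanleyDecomposition (hJ : IsMonomialIdeal J A) (hI : IsMonomialIdeal I B)
    {ι : Type*} [Finite ι] (δ : ι → Fin n →₀ ℕ) (Z : ι → Finset (Fin n))
    (hsub : ∀ i, cell (δ i) (Z i) ⊆ A \ B) (hcover : ∀ α ∈ A \ B, ∃ i, α ∈ cell (δ i) (Z i))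
    (hdisj : ∀ i j α, α ∈ cell (δ i) (Z i) → α ∈ cell (δ j) (Z j) → i = j) :
    ∃ (D : StanleyDecomposition (quotientGrading J I)) (e : Fin D.r ≃ ι), ∀ i, D.Z i = Z (e i) := by
  obtain ⟨r, ⟨e⟩⟩ := Finite.exists_equiv_fin ι
  have hmem : ∀ i, monomial (δ i) (1 : K) ∈ J := fun i =>
    (hJ.monomial_mem_iff one_ne_zero).2 (hsub i (self_mem_cell _ _)).1
  refine ⟨⟨r, fun i => toQuotient I ⟨_, hmem (e.symm i)⟩, fun i => Z (e.symm i),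
    fun i => ⟨_, toQuotient_monomial_mem_quotientGrading _⟩,
    fun i => (injective_stanleyMap_iff hJ hI one_ne_zero _ _).2 (hsub _), ?_⟩, e.symm, fun _ => rfl⟩
  simp only [range_stanleyMap hJ hI one_ne_zero]
  apply DirectSum.isInternal_submodule_of_iSupIndep_of_iSup_eq_top
  · intro i
    rw [← Submodule.span_iUnion₂, ← Set.image_iUnion₂]
    refine (quotientBasis hJ hI).linearIndependent.disjoint_span_image ?_
    rw [Set.disjoint_left]
    intro t hi ht
    obtain ⟨j, hj, hj'⟩ := Set.mem_iUnion₂.1 ht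
    exact hj (e.symm.injective (hdisj _ _ _ hj' hi))
  · rw [← Submodule.span_iUnion, ← Set.image_iUnion, ← (quotientBasis hJ hI).span_eq,
      ← Set.image_univ]
    congr 2
    refine Set.eq_univ_of_forall fun t => ?_
    obtain ⟨i, hi⟩ := hcover t.1 t.2
    exact Set.mem_iUnion.2 ⟨e i, by simpa using hi⟩

end MonomialIdeal

/-! ### Depth from socle elements and regular variables -/

section Depth

variable {K : Type*} [Field K] {n : ℕ}

section General

variable {M : Type*} [AddCommGroup M] [Module (MvPolynomial (Fin n) K) M]

theorem not_isSMulRegular_of_smul_eq_zero {v : M} (hv : v ≠ 0)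
    {f : MvPolynomial (Fin n) K} (h : f • v = 0) : ¬ IsSMulRegular M f := fun hf =>
  hv (hf (h.trans (smul_zero f).symm))

theorem depth_eq_zero {v : M} (hv : v ≠ 0)
    (h : ∀ f ∈ Ideal.span (Set.range (X : Fin n → MvPolynomial (Fin n) K)), f • v = 0) :
    depth K n M = 0 := by
  rw [depth, ← nonpos_iff_eq_zero]
  refine iSup_le ?_
  rintro ⟨_ | ⟨f, rs⟩, hmem, hreg⟩
  · simp
  · rw [RingTheory.Sequence.isRegular_cons_iff] at hreg
    exact absurd hreg.1 (not_isSMulRegular_of_smul_eq_zero hv (h f (hmem f (by simp))))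

theorem depth_le_one
    (h : ∀ f ∈ Ideal.span (Set.range (X : Fin n → MvPolynomial (Fin n) K)), IsSMulRegular M f →
      ∃ w : QuotSMulTop f M, w ≠ 0 ∧
        ∀ g ∈ Ideal.span (Set.range (X : Fin n → MvPolynomial (Fin n) K)), g • w = 0) :
    depth K n M ≤ 1 := by
  refine iSup_le ?_
  rintro ⟨_ | ⟨f, _ | ⟨g, rs⟩⟩, hmem, hreg⟩
  · simp
  · simp
  · rw [RingTheory.Sequence.isRegular_cons_iff, RingTheory.Sequence.isRegular_cons_iff] at hreg
    obtain ⟨w, hw, hw'⟩ := h f (hmem f (by simp)) hreg.1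
    exact absurd hreg.2.1 (not_isSMulRegular_of_smul_eq_zero hw (hw' g (hmem g (by simp))))

theorem one_le_depth {f : MvPolynomial (Fin n) K}
    (hf : f ∈ Ideal.span (Set.range (X : Fin n → MvPolynomial (Fin n) K)))
    (hreg : IsSMulRegular M f) {v : M} (hv : ∀ w : M, f • w ≠ v) : 1 ≤ depth K n M := by
  have hnt : Nontrivial (QuotSMulTop f M) := by
    refine ⟨Submodule.Quotient.mk v, 0, fun h => ?_⟩
    rw [Submodule.Quotient.mk_eq_zero, Submodule.mem_smul_pointwise_iff_exists] at h
    obtain ⟨w, _, hw⟩ := h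
    exact hv w hw
  refine le_iSup_of_le ⟨[f], by simpa using hf, ?_⟩ (by simp)
  rw [RingTheory.Sequence.isRegular_cons_iff]
  exact ⟨hreg, .nil _ _⟩

end General

variable {J I : Ideal (MvPolynomial (Fin n) K)} {A B : Set (Fin n →₀ ℕ)}

theorem mul_mem_of_mem_span_X {L : Ideal (MvPolynomial (Fin n) K)} {u : MvPolynomial (Fin n) K}
    (hu : ∀ i, X i * u ∈ L) {f : MvPolynomial (Fin n) K}
    (hf : f ∈ Ideal.span (Set.range (X : Fin n → MvPolynomial (Fin n) K))) : f * u ∈ L := by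
  induction hf using Submodule.span_induction with
  | mem x hx =>
    obtain ⟨i, rfl⟩ := hx
    exact hu i
  | zero => simp
  | add x y _ _ hx hy => rw [add_mul]; exact L.add_mem hx hy
  | smul c x _ hx => rw [smul_eq_mul, mul_assoc]; exact L.mul_mem_left c hx

theorem depth_quotient_eq_zero {s : MvPolynomial (Fin n) K} (hsJ : s ∈ J) (hsI : s ∉ I)
    (hs : ∀ i, X i * s ∈ I) : depth K n (IdealQuotient J I) = 0 := by
  refine depth_eq_zero (v := toQuotient I ⟨s, hsJ⟩) (by rwa [Ne, toQuotient_eq_zero]) ?_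
  intro f hf
  change toQuotient I (f • ⟨s, hsJ⟩) = 0
  rw [toQuotient_eq_zero]
  exact mul_mem_of_mem_span_X hs hf

theorem IsMonomialIdeal.mem_of_monomial_mul_mem (hI : IsMonomialIdeal I B) {β : Fin n →₀ ℕ}
    (hβ : ∀ α, β + α ∈ B → α ∈ B) {p : MvPolynomial (Fin n) K} (hp : monomial β 1 * p ∈ I) :
    p ∈ I := by
  rw [hI] at hp ⊢
  intro α hα
  refine hβ α (hp _ ?_)
  rw [mem_support_iff, coeff_monomial_mul, one_mul]
  exact mem_support_iff.1 hα

theorem isSMulRegular_toQuotient_iff {f : MvPolynomial (Fin n) K} :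
    IsSMulRegular (IdealQuotient J I) f ↔ ∀ p ∈ J, f * p ∈ I → p ∈ I := by
  rw [isSMulRegular_iff_right_eq_zero_of_smul]
  constructor
  · intro h p hp hfp
    exact toQuotient_eq_zero.1 (h (toQuotient I ⟨p, hp⟩) (toQuotient_eq_zero.2 hfp))
  · intro h v hv
    obtain ⟨p, rfl⟩ := Submodule.Quotient.mk_surjective _ v
    exact toQuotient_eq_zero.2 (h p.1 p.2 (toQuotient_eq_zero.1 hv))

/-- The class of `f * u` is the required socle element modulo `f`: for `g ∈ 𝔪`, `g * (f * u) = f *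
(g * u)` with `g * u ∈ J`. -/
theorem depth_quotient_le_one (hIJ : I ≤ J) {u y : MvPolynomial (Fin n) K} (huJ : u ∉ J)
    (hu : ∀ i, X i * u ∈ J) (hy : y ∈ J) (hyI : ∀ p, y * p ∈ I → p ∈ I) :
    depth K n (IdealQuotient J I) ≤ 1 := by
  refine depth_le_one fun f hf hreg => ?_
  rw [isSMulRegular_toQuotient_iff] at hreg
  refine ⟨Submodule.Quotient.mk (toQuotient I ⟨f * u, mul_mem_of_mem_span_X hu hf⟩), ?_, ?_⟩
  · rw [Ne, Submodule.Quotient.mk_eq_zero, Submodule.mem_smul_pointwise_iff_exists]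
    rintro ⟨w, _, hw⟩
    obtain ⟨j, rfl⟩ := Submodule.Quotient.mk_surjective _ w
    have h1 : f * j.1 - f * u ∈ I := (Submodule.Quotient.eq (Submodule.submoduleOf I J)).1 hw
    -- `f` can only be cancelled on elements of `J`, and `u - j` is not known to lie there; the
    -- factor `y ∈ J` repairs this and is then cancelled modulo `I`.
    have h2 : f * (y * (u - j.1)) ∈ I := by
      have := I.mul_mem_left (-y) h1
      convert this using 1
      ring
    have h3 := hIJ (hyI _ (hreg _ (J.mul_mem_right _ hy) h2))
    exact huJ (by simpa using J.add_mem h3 j.2)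
  · intro g hg
    change Submodule.Quotient.mk (toQuotient I (g • ⟨f * u, mul_mem_of_mem_span_X hu hf⟩)) = _
    rw [Submodule.Quotient.mk_eq_zero, Submodule.mem_smul_pointwise_iff_exists]
    refine ⟨toQuotient I ⟨g * u, mul_mem_of_mem_span_X hu hg⟩, trivial, ?_⟩
    change toQuotient I (f • ⟨g * u, mul_mem_of_mem_span_X hu hg⟩) = _
    congr 1
    exact Subtype.ext (mul_left_comm f g u)

theorem one_le_depth_quotient {l : Fin n} (hreg : ∀ p, X l * p ∈ I → p ∈ I)
    {y : MvPolynomial (Fin n) K} (hyJ : y ∈ J) (hy : ∀ p ∈ J, X l * p - y ∉ I) :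
    1 ≤ depth K n (IdealQuotient J I) := by
  refine one_le_depth (f := X l) (Ideal.subset_span ⟨l, rfl⟩)
    (isSMulRegular_toQuotient_iff.2 fun p _ => hreg p) (v := toQuotient I ⟨y, hyJ⟩) fun w hw => ?_
  obtain ⟨j, rfl⟩ := Submodule.Quotient.mk_surjective _ w
  exact hy j.1 j.2 ((Submodule.Quotient.eq (Submodule.submoduleOf I J)).1 hw)

end Depth

/-! ### Combinatorics of cell partitions: the two bounds -/

section Exponents

variable {n : ℕ}

/-- The exponents of the monomials in the ideal generated by the `x_i ^ e_i` with `i ∈ W`. -/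
def powerExponents (W : Finset (Fin n)) (e : Fin n → ℕ) : Set (Fin n →₀ ℕ) :=
  {α | ∃ i ∈ W, e i ≤ α i}

variable {W : Finset (Fin n)} {a b : Fin n → ℕ}

theorem mem_diff_iff {α : Fin n →₀ ℕ} :
    α ∈ powerExponents Finset.univ a \ powerExponents W b ↔
      (∃ i, a i ≤ α i) ∧ ∀ i ∈ W, α i < b i := by
  simp [powerExponents]

theorem subset_compl_of_cell_subset {δ : Fin n →₀ ℕ} {Z : Finset (Fin n)}
    (h : cell δ Z ⊆ powerExponents Finset.univ a \ powerExponents W b) : Z ⊆ Wᶜ := by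
  classical
  intro l hl
  rw [Finset.mem_compl]
  intro hlW
  -- A free direction in `W` would reach `x_l ^ b l`, hence `I`.
  have hmem : δ + Finsupp.single l (b l) ∈ cell δ Z := by
    refine ⟨le_self_add, fun i hi => ?_⟩
    have : i ≠ l := fun h => hi (h ▸ hl)
    simp [this]
  have := (mem_diff_iff.1 (h hmem)).2 l hlW
  simp at this

/-- Double counting in the two degrees just above the socle monomial `x^c` of `S / J`: each `c +
e_i` with `i ∉ W` has at least `k` successors `c + e_i + e_l` in its own cell, and no successor with
`i ≠ l` is used from both sides. -/
theorem le_of_cell_partition (ha : ∀ i, 1 ≤ a i) (hab : ∀ i ∈ W, a i ≤ b i) {ι : Type*}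
    (δ : ι → Fin n →₀ ℕ) (Z : ι → Finset (Fin n))
    (hsub : ∀ i, cell (δ i) (Z i) ⊆ powerExponents Finset.univ a \ powerExponents W b)
    (hcover : ∀ α ∈ powerExponents Finset.univ a \ powerExponents W b, ∃ i, α ∈ cell (δ i) (Z i))
    (hdisj : ∀ i j α, α ∈ cell (δ i) (Z i) → α ∈ cell (δ j) (Z j) → i = j)
    (hne : Nonempty ι) {k : ℕ} (hk : ∀ i, k ≤ (Z i).card) :
    k ≤ Wᶜ.card - Wᶜ.card / 2 := by
  classical
  obtain ⟨i₀⟩ := hne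
  rcases Nat.eq_zero_or_pos Wᶜ.card with h0 | hpos
  · have := (hk i₀).trans (Finset.card_le_card (subset_compl_of_cell_subset (hsub i₀)))
    omega
  set c : Fin n →₀ ℕ := Finsupp.equivFunOnFinite.symm fun i => a i - 1 with hc
  have hca : ∀ i, c i + 1 = a i := fun i => by
    have := ha i
    simp only [hc, Finsupp.equivFunOnFinite_symm_apply_apply]
    omega
  have hj : ∀ i, ∃ j, i ∉ W → c + Finsupp.single i 1 ∈ cell (δ j) (Z j) := fun i => by
    by_cases hi : i ∈ W
    · exact ⟨i₀, fun h => absurd hi h⟩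
    · obtain ⟨j, hj⟩ := hcover (c + Finsupp.single i 1) (mem_diff_iff.2 ⟨⟨i, by simp [hca]⟩,
        fun l hl => by
          have hli : l ≠ i := fun h => hi (h ▸ hl)
          have := hab l hl
          have := hca l
          simp only [Finsupp.add_apply, Finsupp.single_eq_of_ne hli]
          omega⟩)
      exact ⟨j, fun _ => hj⟩
  choose j hj using hj
  -- The corner of the cell lies in `J` and below `c + e_i`, whose only exponent reaching its bound
  -- is the `i`-th.
  have hδ : ∀ i, i ∉ W → a i ≤ δ (j i) i := fun i hi => by
    obtain ⟨p, hp⟩ := (mem_diff_iff.1 (hsub _ (self_mem_cell (δ (j i)) (Z (j i))))).1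
    have hle := (hj i hi).1 p
    rcases eq_or_ne p i with rfl | hpi
    · exact hp
    · have := hca p
      rw [Finsupp.add_apply, Finsupp.single_eq_of_ne hpi] at hle
      omega
  have hadd : ∀ i, i ∉ W → ∀ l ∈ Z (j i), c + Finsupp.single i 1 + Finsupp.single l 1 ∈
      cell (δ (j i)) (Z (j i)) := fun i hi l hl => by
    refine ⟨(hj i hi).1.trans le_self_add, fun p hp => ?_⟩
    have hpl : p ≠ l := fun h => hp (h ▸ hl)
    rw [Finsupp.add_apply, Finsupp.single_eq_of_ne hpl, add_zero]
    exact (hj i hi).2 p hp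
  have hcount : (Wᶜ.sigma fun i => Z (j i)).card ≤ Wᶜ.sym2.card := by
    refine Finset.card_le_card_of_injOn (fun x => s(x.1, x.2)) ?_ ?_
    · rintro ⟨i, l⟩ h
      rw [Finset.mem_coe, Finset.mem_sigma] at h
      exact Finset.mk_mem_sym2_iff.2 ⟨h.1, subset_compl_of_cell_subset (hsub _) h.2⟩
    · rintro ⟨i, l⟩ h ⟨i', l'⟩ h' heq
      rw [Finset.mem_coe, Finset.mem_sigma, Finset.mem_compl] at h h'
      dsimp only at h h' heq
      rcases Sym2.eq_iff.1 heq with ⟨rfl, rfl⟩ | ⟨rfl, rfl⟩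
      · rfl
      -- Pairs `(i, l)` and `(l, i)` put `c + e_i + e_l` in both cells, so the cells agree. The
      -- common corner then has `l`-th exponent at least `a l` yet lies below `c + e_i`, forcing `l
      -- = i`.
      · have h1 := hadd i h.1 l h.2
        have h2 := hadd l h'.1 i h'.2
        rw [add_right_comm] at h2
        have h3 := hδ l h'.1
        rw [← hdisj _ _ _ h1 h2] at h3
        have h4 := h3.trans ((hj i h.1).1 l)
        rcases eq_or_ne l i with rfl | hli
        · rfl
        · have := hca l
          rw [Finsupp.add_apply, Finsupp.single_eq_of_ne hli] at h4
          omega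
  rw [Finset.card_sigma, Finset.card_sym2] at hcount
  have hlow : Wᶜ.card * k ≤ ∑ i ∈ Wᶜ, (Z (j i)).card := by
    rw [← smul_eq_mul]
    exact Finset.card_nsmul_le_sum _ _ _ fun i _ => hk _
  have h2 : 2 * (Wᶜ.card * k) ≤ (Wᶜ.card + 1) * Wᶜ.card := by
    have := hlow.trans hcount
    rw [Nat.choose_two_right, Nat.add_sub_cancel] at this
    omega
  have h3 : 2 * k ≤ Wᶜ.card + 1 := by
    refine Nat.le_of_mul_le_mul_left ?_ hpos
    linarith
  omega

theorem exists_cell_partition (a b : Fin n → ℕ) (W : Finset (Fin n)) :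
    ∃ P : Set ((Fin n →₀ ℕ) × Finset (Fin n)), P.Finite ∧
      (∀ p ∈ P, cell p.1 p.2 ⊆ powerExponents Finset.univ a \ powerExponents W b) ∧
      (∀ α ∈ powerExponents Finset.univ a \ powerExponents W b, ∃ p ∈ P, α ∈ cell p.1 p.2) ∧
      (∀ p ∈ P, ∀ q ∈ P, ∀ α, α ∈ cell p.1 p.2 → α ∈ cell q.1 q.2 → p = q) ∧
      ∀ p ∈ P, Wᶜ.card - Wᶜ.card / 2 ≤ p.2.card := by
  classical
  obtain ⟨X, Y, hXY⟩ := exists_interval_partition_finset Wᶜ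
  let S : (Fin n →₀ ℕ) → Finset (Fin n) := fun α => Wᶜ.filter fun i => a i ≤ α i
  -- If a `W`-exponent already ensures membership in `J`, all of `Wᶜ` can be free. Otherwise the
  -- interval of `S α` gives the free directions, and its nonempty bottom keeps the cell inside `J`.
  let F : (Fin n →₀ ℕ) → (Fin n →₀ ℕ) × Finset (Fin n) := fun α =>
    if ∃ i ∈ W, a i ≤ α i then
      (Finsupp.equivFunOnFinite.symm fun i => if i ∈ W then α i else 0, Wᶜ)
    else
      (Finsupp.equivFunOnFinite.symm fun i =>
        if i ∈ Y (S α) then if i ∈ X (S α) then a i else 0 else α i, Y (S α))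
  let T : Set (Fin n →₀ ℕ) := powerExponents Finset.univ a \ powerExponents W b
  have hS : ∀ α ∈ T, ¬ (∃ i ∈ W, a i ≤ α i) → (S α).Nonempty := by
    intro α hα hW
    obtain ⟨i, hi⟩ := (mem_diff_iff.1 hα).1
    exact ⟨i, Finset.mem_filter.2 ⟨Finset.mem_compl.2 fun hiW => hW ⟨i, hiW, hi⟩, hi⟩⟩
  have hmem : ∀ α ∈ T, α ∈ cell (F α).1 (F α).2 := by
    intro α hα
    by_cases hW : ∃ i ∈ W, a i ≤ α i
    · simp only [F, if_pos hW]
      refine ⟨fun i => ?_, fun i hi => ?_⟩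
      · rw [Finsupp.equivFunOnFinite_symm_apply_apply]
        split_ifs <;> simp
      · rw [Finsupp.equivFunOnFinite_symm_apply_apply, if_pos (by simpa using hi)]
    · obtain ⟨h1, h2, h3, h4, h5, h6⟩ := hXY (S α) (Finset.filter_subset _ _) (hS α hα hW)
      simp only [F, if_neg hW]
      refine ⟨fun i => ?_, fun i hi => ?_⟩
      · rw [Finsupp.equivFunOnFinite_symm_apply_apply]
        split_ifs with hY hX
        · exact (Finset.mem_filter.1 (h1 hX)).2
        · simp
        · rfl
      · rw [Finsupp.equivFunOnFinite_symm_apply_apply, if_neg hi]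
  -- `F` is constant on each cell it produces, which yields disjointness.
  have hinv : ∀ α ∈ T, ∀ γ ∈ cell (F α).1 (F α).2, γ ∈ T ∧ F γ = F α := by
    intro α hα γ hγ
    obtain ⟨-, hαb⟩ := mem_diff_iff.1 hα
    by_cases hW : ∃ i ∈ W, a i ≤ α i
    · simp only [F, if_pos hW] at hγ
      have heq : ∀ i ∈ W, γ i = α i := fun i hi => by
        rw [hγ.2 i (by simpa using hi), Finsupp.equivFunOnFinite_symm_apply_apply, if_pos hi]
      have hWγ : ∃ i ∈ W, a i ≤ γ i := by
        obtain ⟨i, hi, hia⟩ := hW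
        exact ⟨i, hi, by rwa [heq i hi]⟩
      refine ⟨mem_diff_iff.2 ⟨?_, fun i hi => by rw [heq i hi]; exact hαb i hi⟩, ?_⟩
      · obtain ⟨i, -, hia⟩ := hWγ
        exact ⟨i, hia⟩
      · simp only [F, if_pos hW, if_pos hWγ]
        congr 2
        funext i
        split_ifs with hi
        · exact heq i hi
        · rfl
    · obtain ⟨h1, h2, h3, h4, h5, h6⟩ := hXY (S α) (Finset.filter_subset _ _) (hS α hα hW)
      simp only [F, if_neg hW] at hγ
      have heq : ∀ i, i ∉ Y (S α) → γ i = α i := fun i hi => by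
        rw [hγ.2 i hi, Finsupp.equivFunOnFinite_symm_apply_apply, if_neg hi]
      have hYW : ∀ i ∈ W, i ∉ Y (S α) := fun i hi hiY => Finset.mem_compl.1 (h3 hiY) hi
      have hWγ : ¬ ∃ i ∈ W, a i ≤ γ i := by
        rintro ⟨i, hi, hia⟩
        exact hW ⟨i, hi, by rwa [← heq i (hYW i hi)]⟩
      have hXγ : ∀ i ∈ X (S α), a i ≤ γ i := fun i hi => by
        have := hγ.1 i
        rwa [Finsupp.equivFunOnFinite_symm_apply_apply, if_pos (h2 (h1 hi)), if_pos hi] at this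
      obtain ⟨hX, hY⟩ := h6 (S γ)
        (fun i hi => Finset.mem_filter.2 ⟨h3 (h2 (h1 hi)), hXγ i hi⟩)
        (fun i hi => by
          by_contra hiY
          obtain ⟨hiW, hia⟩ := Finset.mem_filter.1 hi
          rw [heq i hiY] at hia
          exact hiY (h2 (Finset.mem_filter.2 ⟨hiW, hia⟩)))
      refine ⟨mem_diff_iff.2 ⟨?_, fun i hi => by rw [heq i (hYW i hi)]; exact hαb i hi⟩, ?_⟩
      · obtain ⟨i, hi⟩ := h4
        exact ⟨i, hXγ i hi⟩
      · simp only [F, if_neg hW, if_neg hWγ, hX, hY]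
        congr 2
        funext i
        split_ifs with hiY
        · rfl
        · rfl
        · exact heq i hiY
  refine ⟨F '' T, ?_, ?_, ?_, ?_, ?_⟩
  · have hfin : (Set.Icc (0 : Fin n →₀ ℕ) (Finsupp.equivFunOnFinite.symm fun i => a i + b i) ×ˢ
        (Set.univ : Set (Finset (Fin n)))).Finite := (Set.finite_Icc _ _).prod Set.finite_univ
    refine hfin.subset ?_
    rintro _ ⟨α, hα, rfl⟩
    refine ⟨⟨zero_le, fun i => ?_⟩, trivial⟩
    obtain ⟨-, hαb⟩ := mem_diff_iff.1 hα
    rw [Finsupp.equivFunOnFinite_symm_apply_apply]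
    by_cases hW : ∃ i ∈ W, a i ≤ α i
    · simp only [F, if_pos hW, Finsupp.equivFunOnFinite_symm_apply_apply]
      split_ifs with hi
      · have := hαb i hi
        omega
      · exact Nat.zero_le _
    · obtain ⟨h1, h2, h3, h4, h5, h6⟩ := hXY (S α) (Finset.filter_subset _ _) (hS α hα hW)
      simp only [F, if_neg hW, Finsupp.equivFunOnFinite_symm_apply_apply]
      split_ifs with hiY hiX
      · exact Nat.le_add_right _ _
      · exact Nat.zero_le _
      · by_cases hi : i ∈ W
        · have := hαb i hi
          omega
        · have : ¬ a i ≤ α i := fun h =>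
            hiY (h2 (Finset.mem_filter.2 ⟨Finset.mem_compl.2 hi, h⟩))
          omega
  · rintro _ ⟨α, hα, rfl⟩ γ hγ
    exact (hinv α hα γ hγ).1
  · intro α hα
    exact ⟨F α, ⟨α, hα, rfl⟩, hmem α hα⟩
  · rintro _ ⟨α, hα, rfl⟩ _ ⟨β, hβ, rfl⟩ γ hγα hγβ
    rw [← (hinv α hα γ hγα).2, (hinv β hβ γ hγβ).2]
  · rintro _ ⟨α, hα, rfl⟩
    by_cases hW : ∃ i ∈ W, a i ≤ α i
    · simp only [F, if_pos hW]
      exact Nat.sub_le _ _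
    · obtain ⟨h1, h2, h3, h4, h5, h6⟩ := hXY (S α) (Finset.filter_subset _ _) (hS α hα hW)
      simp only [F, if_neg hW]
      omega

end Exponents

/-! ### Stanley depth and depth for ideals of pure powers -/

section PowerIdeals

variable {K : Type*} [Field K] {n : ℕ} {J I : Ideal (MvPolynomial (Fin n) K)}

theorem isMonomialIdeal_powerExponents {k : ℕ} (h : k ≤ n) (e : Fin k → ℕ) (e' : Fin n → ℕ)
    (he : ∀ i, e' (Fin.castLE h i) = e i) :
    IsMonomialIdeal (powerIdeal K h e)
      (powerExponents (Finset.univ.filter fun i : Fin n => i.1 < k) e') := by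
  have : powerExponents (Finset.univ.filter fun i : Fin n => i.1 < k) e' =
      {α | ∃ i, e i ≤ α (Fin.castLE h i)} := by
    ext α
    constructor
    · rintro ⟨i, hi, hle⟩
      have hik : i.1 < k := (Finset.mem_filter.1 hi).2
      refine ⟨⟨i, hik⟩, ?_⟩
      rw [← he]
      exact hle
    · rintro ⟨i, hle⟩
      refine ⟨Fin.castLE h i, Finset.mem_filter.2 ⟨Finset.mem_univ _, i.2⟩, ?_⟩
      rwa [he]
  rw [this]
  exact isMonomialIdeal_powerIdeal h e

theorem IsMonomialIdeal.exists_mem_diff {A B : Set (Fin n →₀ ℕ)} (hJ : IsMonomialIdeal J A)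
    (hI : IsMonomialIdeal I B) (h : ¬ J ≤ I) : (A \ B).Nonempty := by
  obtain ⟨p, hpJ, hpI⟩ := Set.not_subset.1 h
  rw [SetLike.mem_coe, hI] at hpI
  push Not at hpI
  obtain ⟨α, hα, hB⟩ := hpI
  exact ⟨α, (hJ p).1 hpJ α hα, hB⟩

variable {W : Finset (Fin n)} {a b : Fin n → ℕ}

theorem isGreatest_sdepth (ha : ∀ i, 1 ≤ a i) (hab : ∀ i ∈ W, a i ≤ b i)
    (hJ : IsMonomialIdeal J (powerExponents Finset.univ a))
    (hI : IsMonomialIdeal I (powerExponents W b))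
    (hne : (powerExponents Finset.univ a \ powerExponents W b).Nonempty) :
    IsGreatest (Set.range fun D : StanleyDecomposition (quotientGrading J I) => D.sdepth)
      (Wᶜ.card - Wᶜ.card / 2) := by
  obtain ⟨α, hα⟩ := hne
  have hupper : ∀ D : StanleyDecomposition (quotientGrading J I),
      D.sdepth ≤ Wᶜ.card - Wᶜ.card / 2 := by
    intro D
    obtain ⟨δ, hsub, hcover, hdisj⟩ := D.exists_cells hJ hI
    obtain ⟨i, -⟩ := hcover α hα
    exact le_of_cell_partition ha hab δ D.Z hsub hcover hdisj ⟨i⟩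
      fun i => ciInf_le (OrderBot.bddBelow _) i
  constructor
  · obtain ⟨P, hfin, hsub, hcover, hdisj, hcard⟩ := exists_cell_partition a b W
    have := hfin.to_subtype
    obtain ⟨D, e, hD⟩ := exists_stanleyDecomposition hJ hI (ι := P) (fun p => p.1.1)
      (fun p => p.1.2) (fun p => hsub p.1 p.2)
      (fun β hβ => by
        obtain ⟨p, hp, hβp⟩ := hcover β hβ
        exact ⟨⟨p, hp⟩, hβp⟩)
      (fun p q β hp hq => Subtype.ext (hdisj p.1 p.2 q.1 q.2 β hp hq))
    refine ⟨D, le_antisymm (hupper D) ?_⟩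
    obtain ⟨p, hp, -⟩ := hcover α hα
    have : Nonempty (Fin D.r) := ⟨e.symm ⟨p, hp⟩⟩
    refine le_ciInf fun i => ?_
    rw [hD]
    exact hcard _ (e i).2
  · rintro _ ⟨D, rfl⟩
    exact hupper D

theorem depth_eq_zero_of_powerExponents (hab : ∀ i, 1 ≤ b i)
    (hJ : IsMonomialIdeal J (powerExponents Finset.univ a))
    (hI : IsMonomialIdeal I (powerExponents Finset.univ b))
    (hne : (powerExponents Finset.univ a \ powerExponents Finset.univ b).Nonempty) :
    depth K n (IdealQuotient J I) = 0 := by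
  obtain ⟨α, hα⟩ := hne
  obtain ⟨⟨i, hi⟩, hαb⟩ := mem_diff_iff.1 hα
  set c : Fin n →₀ ℕ := Finsupp.equivFunOnFinite.symm fun i => b i - 1 with hc
  have hcb : ∀ i, c i + 1 = b i := fun i => by
    have := hab i
    simp only [hc, Finsupp.equivFunOnFinite_symm_apply_apply]
    omega
  -- The socle monomial `x^(b-1)` of `S / I` lies in `J` because `I ≠ J` gives some `a i < b i`.
  refine depth_quotient_eq_zero (s := monomial c 1) ?_ ?_ fun l => ?_
  · rw [hJ.monomial_mem_iff one_ne_zero]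
    have := hαb i (Finset.mem_univ i)
    have := hcb i
    exact ⟨i, Finset.mem_univ i, by omega⟩
  · rw [hI.monomial_mem_iff one_ne_zero]
    rintro ⟨l, -, hl⟩
    have := hcb l
    omega
  · rw [X, monomial_mul, one_mul, hI.monomial_mem_iff one_ne_zero]
    exact ⟨l, Finset.mem_univ l, by simp [← hcb l, add_comm]⟩

theorem depth_eq_one_of_powerExponents (ha : ∀ i, 1 ≤ a i) (hab : ∀ i ∈ W, a i ≤ b i)
    (hJ : IsMonomialIdeal J (powerExponents Finset.univ a))
    (hI : IsMonomialIdeal I (powerExponents W b)) (hIJ : I ≤ J) {l : Fin n} (hl : l ∉ W) :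
    depth K n (IdealQuotient J I) = 1 := by
  classical
  have hshift : ∀ k α, Finsupp.single l k + α ∈ powerExponents W b → α ∈ powerExponents W b := by
    rintro k α ⟨i, hi, hle⟩
    have hil : i ≠ l := fun h => hl (h ▸ hi)
    rw [Finsupp.add_apply, Finsupp.single_eq_of_ne hil, zero_add] at hle
    exact ⟨i, hi, hle⟩
  have hyJ : monomial (Finsupp.single l (a l)) 1 ∈ J := by
    rw [hJ.monomial_mem_iff one_ne_zero]
    exact ⟨l, Finset.mem_univ l, by simp⟩
  apply le_antisymm
  · set c : Fin n →₀ ℕ := Finsupp.equivFunOnFinite.symm fun i => a i - 1 with hc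
    have hca : ∀ i, c i + 1 = a i := fun i => by
      have := ha i
      simp only [hc, Finsupp.equivFunOnFinite_symm_apply_apply]
      omega
    refine depth_quotient_le_one hIJ (u := monomial c 1) ?_ (fun i => ?_) hyJ
      fun p => hI.mem_of_monomial_mul_mem (hshift _)
    · rw [hJ.monomial_mem_iff one_ne_zero]
      rintro ⟨i, -, hi⟩
      have := hca i
      omega
    · rw [X, monomial_mul, one_mul, hJ.monomial_mem_iff one_ne_zero]
      exact ⟨i, Finset.mem_univ i, by simp [← hca i, add_comm]⟩
  · refine one_le_depth_quotient (fun p => hI.mem_of_monomial_mul_mem (hshift 1)) hyJ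
      fun p hp hmem => ?_
    have hsplit : Finsupp.single l (a l) = Finsupp.single l 1 + Finsupp.single l (a l - 1) := by
      rw [← Finsupp.single_add, Nat.add_sub_cancel' (ha l)]
    -- `x_l ^ (a l - 1) ∉ J`, so `x_l ^ a l` cannot come from `x_l J`; nor can `I` supply it, as `l
    -- ∉ W`.
    have hcoeffp : coeff (Finsupp.single l (a l - 1)) p = 0 := by
      by_contra h0
      obtain ⟨i, -, hi⟩ := (hJ p).1 hp _ (mem_support_iff.2 h0)
      have := ha i
      rcases eq_or_ne i l with rfl | hil
      · rw [Finsupp.single_eq_same] at hi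
        omega
      · rw [Finsupp.single_eq_of_ne hil] at hi
        omega
    have hcoeff : coeff (Finsupp.single l (a l))
        (X l * p - monomial (Finsupp.single l (a l)) 1) = -1 := by
      rw [coeff_sub, coeff_monomial, if_pos rfl, hsplit, coeff_X_mul, hcoeffp, zero_sub]
    obtain ⟨i, hi, hle⟩ := (hI _).1 hmem _
      (mem_support_iff.2 (hcoeff.trans_ne (neg_ne_zero.2 one_ne_zero)))
    have hil : i ≠ l := fun h => hl (h ▸ hi)
    rw [Finsupp.single_eq_of_ne hil] at hle
    have := ha i
    have := hab i hi
    omega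

end PowerIdeals

end StanleyDepth

end

open StanleyDepth in
theorem theorem1p5 (K : Type*) [Field K] (m n : ℕ) (hmn : m ≤ n)
    (a : Fin n → ℕ) (b : Fin m → ℕ) (ha : ∀ i, 1 ≤ a i)
    (hab : ∀ i : Fin m, a (Fin.castLE hmn i) ≤ b i)
    (J I : Ideal (MvPolynomial (Fin n) K))
    (hJ : J = powerIdeal K le_rfl a) (hI : I = powerIdeal K hmn b)
    (hIJ : I ≠ J) :
    -- the maximum in the definition of the Stanley depth exists
    IsGreatest (Set.range fun D : StanleyDecomposition (quotientGrading J I) => D.sdepth)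
      (sdepth (quotientGrading J I)) ∧
    sdepth (quotientGrading J I) = n - m - (n - m) / 2 ∧
    depth K n (IdealQuotient J I) = (if m < n then 1 else 0) ∧
    depth K n (IdealQuotient J I) ≤ (sdepth (quotientGrading J I) : ℕ∞) := by
  classical
  -- The default `0` is harmless: only values on `W` matter for `powerExponents W b'`.
  let b' : Fin n → ℕ := fun i => if h : i.1 < m then b ⟨i, h⟩ else 0
  let W : Finset (Fin n) := Finset.univ.filter fun i : Fin n => i.1 < m
  have hbW : ∀ i ∈ W, a i ≤ b' i := fun i hi => by
    have him : i.1 < m := (Finset.mem_filter.1 hi).2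
    simp only [b', dif_pos him]
    exact hab ⟨i, him⟩
  have hJm : IsMonomialIdeal J (powerExponents Finset.univ a) := by
    have := isMonomialIdeal_powerExponents (K := K) le_rfl a a fun _ => rfl
    rw [hJ]
    simpa using this
  have hIm : IsMonomialIdeal I (powerExponents W b') := by
    rw [hI]
    exact isMonomialIdeal_powerExponents hmn b b' fun i => by simp [b']
  have hle : I ≤ J := fun p hp => by
    rw [hJm]
    intro α hα
    obtain ⟨i, hi, hle⟩ := (hIm p).1 hp α hα
    exact ⟨i, Finset.mem_univ i, (hbW i hi).trans hle⟩
  have hne := hJm.exists_mem_diff hIm fun h => hIJ (le_antisymm hle h)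
  have hW : W.card = m := by
    rw [show W = Finset.univ.map (Fin.castLEEmb hmn) from ?_, Finset.card_map, Finset.card_univ,
      Fintype.card_fin]
    ext i
    simp only [W, Finset.mem_filter, Finset.mem_univ, true_and, Finset.mem_map]
    exact ⟨fun h => ⟨⟨i, h⟩, rfl⟩, by rintro ⟨j, rfl⟩; exact j.2⟩
  have hWc : Wᶜ.card = n - m := by rw [Finset.card_compl, hW, Fintype.card_fin]
  have hgr := isGreatest_sdepth ha hbW hJm hIm hne
  rw [hWc] at hgr
  have hsd : sdepth (quotientGrading J I) = n - m - (n - m) / 2 := hgr.csSup_eq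
  have hdepth : depth K n (IdealQuotient J I) = (if m < n then 1 else 0) := by
    split_ifs with hlt
    · exact depth_eq_one_of_powerExponents ha hbW hJm hIm hle (l := ⟨m, hlt⟩) (by simp [W])
    · have hWu : W = Finset.univ := by
        rw [← Finset.card_eq_iff_eq_univ, hW, Fintype.card_fin]
        omega
      rw [hWu] at hIm hne hbW
      exact depth_eq_zero_of_powerExponents
        (fun i => (ha i).trans (hbW i (Finset.mem_univ i))) hJm hIm hne
  refine ⟨hsd ▸ hgr, hsd, hdepth, ?_⟩
  rw [hdepth, hsd]
  split_ifs with hlt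
  · exact_mod_cast (by omega : 1 ≤ n - m - (n - m) / 2)
  · exact zero_le
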